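/- Let $I$ (individuals) and $\mathsf{At}$ (atomic formulas) be non-empty sets. The language $\mathcal L_{\mathsf{At}}$ is $\varphi::=\top\mid p\mid\neg\varphi\mid\varphi\wedge\varphi\mid \ell_i\varphi\mid a_i\varphi\mid k_i\varphi$ with $p\in\mathsf{At}$, $i\in I$ ($\ell_i$: implicit knowledge, $a_i$: awareness, $k_i$: explicit knowledge); $\to,\leftrightarrow$ are the usual abbreviations, $\mathsf{At}(\varphi)$ is the set of atoms occurring in $\varphi$, and $\mathcal L_\Phi=\{\varphi:\mathsf{At}(\varphi)\subseteq\Phi\}$ for $\Phi\subseteq\mathsf{At}$. **Logic.** The Logic of Propositional Awareness LPA is the smallest set of formulas containing all substitution instances of propositional tautologies and all instances of $(\ell_i\varphi\wedge \ell_i(\varphi\to\psi))\to \ell_i\psi$; $k_i\varphi\leftrightarrow(\ell_i\varphi\wedge a_i\varphi)$; $a_i(\varphi\wedge\psi)\leftrightarrow(a_i\varphi\wedge a_i\psi)$; $a_i\neg\varphi\leftrightarrow a_i\varphi$; $a_ik_j\varphi\leftrightarrow a_i\varphi$; $a_ia_j\varphi\leftrightarrow a_i\varphi$; $a_i\ell_j\varphi\leftrightarrow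 a_i\varphi$; $a_i\top$; $a_i\varphi\to\ell_ia_i\varphi$; $\neg a_i\varphi\to\ell_i\neg a_i\varphi$; $\ell_i\varphi\to\varphi$; $\ell_i\varphi\to\ell_i\ell_i\varphi$; $\neg\ell_i\varphi\to\ell_i\neg\ell_i\varphi$; and closed under modus ponens and under the rule "from $\varphi$ infer $\ell_i\varphi$". Let LPA$^-$ be the same system without the axiom $a_i\top$. **Categories of FH models.** An FH model $\mathsf K_\Phi$ for $\Phi\subseteq\mathsf{At}$ consists of a non-empty set $W_\Phi$, equivalence relations $R_{\Phi,i}$ on $W_\Phi$, awareness sets $\mathcal A_{\Phi,i}(w)\subseteq\mathcal L_\Phi$ and $V_\Phi:\Phi\to2^{W_\Phi}$, such that for all $\varphi\in\mathcal L_\Phi$, $\varphi\in\mathcal A_{\Phi,i}(w)$ iff $p\in\mathcal A_{\Phi,i}(w)$ for all $p\in\mathsf{At}(\varphi)$, and $(w,t)\in R_{\Phi,i}$ implies $\mathcal A_{\Phi,i}(w)=\mathcal A_{\Phi,i}(t)$. Satisfaction of formulas of $\mathcal L_\Phi$ is as in Kripke models, $\ell_i$ being the box of $R_{\Phi,i}$,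 with $w\Vdash a_i\varphi$ iff $\varphi\in\mathcal A_{\Phi,i}(w)$, and $w\Vdash k_i\varphi$ iff $w\Vdash\ell_i\varphi$ and $w\Vdash a_i\varphi$. For $\Psi\subseteq\Phi$, a surjective bounded morphism $f:\mathsf K_\Phi\to\mathsf K_\Psi$ is a surjection $W_\Phi\to W_\Psi$ such that: $w\in V_\Phi(p)$ iff $f(w)\in V_\Psi(p)$ for $p\in\Psi$; $\mathcal A_{\Phi,i}(w)\cap\mathcal L_\Psi=\mathcal A_{\Psi,i}(f(w))$; $(w,t)\in R_{\Phi,i}$ implies $(f(w),f(t))\in R_{\Psi,i}$; and if $(f(w),t')\in R_{\Psi,i}$ there is $t$ with $f(t)=t'$ and $(w,t)\in R_{\Phi,i}$. A category of FH models consists of one FH model $\mathsf K_\Phi$ for each $\Phi\subseteq\mathsf{At}$ and one surjective bounded morphism $f^\Phi_\Psi$ for all $\Psi\subseteq\Phi$, with $f^\Phi_\Phi=\mathrm{id}$ and $f^\Phi_\Upsilon=f^\Psi_\Upsilon\circ f^\Phi_\Psi$. A formula is defined in $\mathsf K_\Phi$ if $\mathsf{At}(\varphi)\subseteq\Phi$.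 **State spaces and events.** Let $\{S_\Phi\}_{\Phi\subseteq\mathsf{At}}$ be non-empty disjoint sets, ordered by $S_\Psi\preceq S_\Phi$ iff $\Psi\subseteq\Phi$, with surjections $r^\Phi_\Psi:S_\Phi\to S_\Psi$ ($\Psi\subseteq\Phi$), $r^\Phi_\Phi=\mathrm{id}$, $r^\Phi_\Upsilon=r^\Psi_\Upsilon\circ r^\Phi_\Psi$; write $\Omega=\bigcup_\Phi S_\Phi$, $\omega_\Psi=r^\Phi_\Psi(\omega)$ for $\omega\in S_\Phi$, and $D_\Psi\subseteq S_\Psi$ for the projection of a set $D$ of states to $S_\Psi$. For $D\subseteq S_\Phi$ let $D^\uparrow=\bigcup_{\Psi\supseteq\Phi}(r^\Psi_\Phi)^{-1}(D)$. An event $E$ is given by a base-space $S(E)=S_\Phi$ and a base $D\subseteq S_\Phi$, and has $D^\uparrow$ as its set of states; $\neg E=(S_\Phi\setminus D)^\uparrow$. Empty events with different base-spaces are distinguished; negation and the epistemic operators keep the base-space, the base-space of an intersection is the join of the base-spaces, and the base-space of $[\top]=\Omega$ is $S_\emptyset$. **Complemented HMS models** consist of such spaces and projections, $\Pi_i:\Omega\to2^\Omega\setminus\{\emptyset\}$,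 $\Lambda_i:\Omega\to2^\Omega$ ($i\in I$), and a valuation $v$ from $\mathsf{At}$ to events. For $\omega\in S_\Phi$, $\Pi_i$ satisfies: $\Pi_i(\omega)\subseteq S_\Psi$ for some $\Psi\subseteq\Phi$ (write $S_{\Pi_i(\omega)}$ for this $S_\Psi$); $\omega\in\Pi_i(\omega)^\uparrow$; $\omega'\in\Pi_i(\omega)$ implies $\Pi_i(\omega')=\Pi_i(\omega)$; $\Pi_i(\omega)^\uparrow\subseteq\Pi_i(\omega_\Psi)^\uparrow$ for $\Psi\subseteq\Phi$; if $\Upsilon\subseteq\Psi\subseteq\Phi$ and $\Pi_i(\omega)\subseteq S_\Psi$ then $\Pi_i(\omega)_\Upsilon=\Pi_i(\omega_\Upsilon)$. And $\Lambda_i$ satisfies: (R) $\omega\in\Lambda_i(\omega)$; (S) $\omega'\in\Lambda_i(\omega)$ implies $\Lambda_i(\omega')=\Lambda_i(\omega)$; (P) $\Lambda_i(\omega)_\Psi=\Lambda_i(\omega_\Psi)$ for $\omega\in S_\Phi$, $\Psi\subseteq\Phi$; $\omega'\in\Lambda_i(\omega)$ implies $\Pi_i(\omega')=\Pi_i(\omega)$;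 $\omega'\in\Pi_i(\omega)$ implies $\Lambda_i(\omega')=\Lambda_i(\omega)_{S_{\Pi_i(\omega)}}$. With $[\varphi]=\{\omega:\omega\vDash\varphi\}$, satisfaction is: $\omega\vDash\top$ always; $\omega\vDash p$ iff $\omega\in v(p)$; $\omega\vDash\neg\varphi$ iff $\omega\in\neg[\varphi]$; $\omega\vDash\varphi\wedge\psi$ iff $\omega\in[\varphi]\cap[\psi]$; $\omega\vDash\ell_i\varphi$ iff $\Lambda_i(\omega)\subseteq[\varphi]$; $\omega\vDash k_i\varphi$ iff $\Pi_i(\omega)\subseteq[\varphi]$; $\omega\vDash a_i\varphi$ iff $S_{\Pi_i(\omega)}\succeq S([\varphi])$. **Implicit knowledge-based HMS models** consist of such spaces and projections, a valuation $v$ from $\mathsf{At}$ to events, $\Lambda^*_i:\Omega\to2^\Omega\setminus\{\emptyset\}$ satisfying (R), (S), (P), and awareness functions $\alpha_i:\Omega\to\{S_\Phi\}_\Phi$ such that for $\omega\in S_\Phi$: $\alpha_i(\omega)\preceq S_\Phi$; $\omega'\in\Lambda_i^*(\omega)$ implies $\alpha_i(\omega')=\alpha_i(\omega)$; $S_\Psi\preceq\alpha_i(\omega)$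 implies $\alpha_i(\omega_\Psi)=S_\Psi$; $\alpha_i(\omega)\preceq S_\Psi\preceq S_\Phi$ implies $\alpha_i(\omega_\Psi)=\alpha_i(\omega)$; $\Psi\subseteq\Phi$ implies $\alpha_i(\omega_\Psi)\preceq\alpha_i(\omega)$. Satisfaction is as above with $\Lambda^*_i$ in place of $\Lambda_i$, with $\Pi^*_i(\omega):=\Lambda^*_i(\omega)_{\alpha_i(\omega)}$ in place of $\Pi_i$, and with $\omega\vDash a_i\varphi$ iff $\alpha_i(\omega)\succeq S([\varphi])$. In both kinds of HMS models $\varphi$ is defined at $\omega$ if $\omega\in v(p)\cup\neg v(p)$ for all $p\in\mathsf{At}(\varphi)$. A formula is valid in a class if it is true in every member of the class at every state at which it is defined. A logic is sound for a set of formulas with respect to a class if each of its theorems in the set is valid in the class, and complete if each formula of the set that is valid in the class is a theorem. **Corollary.** LPA is sound and complete for $\mathcal L_{\mathsf{At}}$ with respect to 1. the class of categories of FH models, 2. the class of complemented HMS models, 3. the class of implicit knowledge-based HMS models. Moreover, LPA$^-$ is sound and complete with respect to each of these three classes for the formulas in which $\top$ does not occur. -/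

import Mathlib

universe u v w

namespace LPA

/-! ### Language -/

/-- The language with implicit knowledge, awareness and explicit knowledge, for individuals `I`
and atomic formulas `At`. -/
inductive Form (I : Type u) (At : Type v) : Type (max u v)
  | top : Form I At
  | atom : At → Form I At
  | neg : Form I At → Form I At
  | and : Form I At → Form I At → Form I At
  | impl : I → Form I At → Form I At
  | aware : I → Form I At → Form I At
  | expl : I → Form I At → Form I At

namespace Form

variable {I : Type u} {At : Type v}

/-- Material implication, as an abbreviation. -/
def imp (φ ψ : Form I At) : Form I At := neg (and φ (neg ψ))

/-- Material equivalence, as an abbreviation. -/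
def iff (φ ψ : Form I At) : Form I At := and (imp φ ψ) (imp ψ φ)

/-- The set of atomic formulas that occur in a formula. -/
def atoms : Form I At → Set At
  | top => ∅
  | atom p => {p}
  | neg φ => atoms φ
  | and φ ψ => atoms φ ∪ atoms ψ
  | impl _ φ => atoms φ
  | aware _ φ => atoms φ
  | expl _ φ => atoms φ

/-- The constant `⊤` does not occur in the formula. -/
def TopFree : Form I At → Prop
  | top => False
  | atom _ => True
  | neg φ => TopFree φ
  | and φ ψ => TopFree φ ∧ TopFree ψ
  | impl _ φ => TopFree φ
  | aware _ φ => TopFree φ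
  | expl _ φ => TopFree φ

end Form

/-- The sublanguage of formulas all of whose atoms lie in `Φ`. -/
def sublanguage (I : Type u) {At : Type v} (Φ : Set At) : Set (Form I At) :=
  {φ | φ.atoms ⊆ Φ}

/-! ### The axiom system -/

/-- Formulas of classical propositional logic, with variables indexed by `ℕ`. -/
inductive PForm : Type
  | top : PForm
  | var : ℕ → PForm
  | neg : PForm → PForm
  | and : PForm → PForm → PForm

namespace PForm

/-- Truth of a propositional formula under an assignment. -/
def eval (e : ℕ → Prop) : PForm → Prop
  | top => True
  | var n => e n
  | neg t => ¬ eval e t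
  | and s t => eval e s ∧ eval e t

/-- A propositional formula that is true under all assignments. -/
def IsTautology (t : PForm) : Prop := ∀ e : ℕ → Prop, t.eval e

/-- Substitution of modal formulas for propositional variables. -/
def subst {I : Type u} {At : Type v} (σ : ℕ → Form I At) : PForm → Form I At
  | top => Form.top
  | var n => σ n
  | neg t => Form.neg (subst σ t)
  | and s t => Form.and (subst σ s) (subst σ t)

end PForm

/-- The smallest set of formulas that contains the formulas in `X` and the listed axioms and is
closed under modus ponens and necessitation for implicit knowledge. -/
inductive Provable {I : Type u} {At : Type v} (X : Set (Form I At)) : Form I At → Prop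
  | extra {φ : Form I At} (h : φ ∈ X) : Provable X φ
  | taut (t : PForm) (ht : t.IsTautology) (σ : ℕ → Form I At) : Provable X (t.subst σ)
  | distribution (i : I) (φ ψ : Form I At) :
      Provable X (((Form.impl i φ).and (Form.impl i (φ.imp ψ))).imp (Form.impl i ψ))
  | explicit (i : I) (φ : Form I At) :
      Provable X ((Form.expl i φ).iff ((Form.impl i φ).and (Form.aware i φ)))
  | aware_and (i : I) (φ ψ : Form I At) :
      Provable X ((Form.aware i (φ.and ψ)).iff ((Form.aware i φ).and (Form.aware i ψ)))
  | aware_neg (i : I) (φ : Form I At) :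
      Provable X ((Form.aware i φ.neg).iff (Form.aware i φ))
  | aware_expl (i j : I) (φ : Form I At) :
      Provable X ((Form.aware i (Form.expl j φ)).iff (Form.aware i φ))
  | aware_aware (i j : I) (φ : Form I At) :
      Provable X ((Form.aware i (Form.aware j φ)).iff (Form.aware i φ))
  | aware_impl (i j : I) (φ : Form I At) :
      Provable X ((Form.aware i (Form.impl j φ)).iff (Form.aware i φ))
  | awareness_introspection (i : I) (φ : Form I At) :
      Provable X ((Form.aware i φ).imp (Form.impl i (Form.aware i φ)))
  | unawareness_introspection (i : I) (φ : Form I At) :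
      Provable X ((Form.aware i φ).neg.imp (Form.impl i (Form.aware i φ).neg))
  | truth (i : I) (φ : Form I At) : Provable X ((Form.impl i φ).imp φ)
  | positive_introspection (i : I) (φ : Form I At) :
      Provable X ((Form.impl i φ).imp (Form.impl i (Form.impl i φ)))
  | negative_introspection (i : I) (φ : Form I At) :
      Provable X ((Form.impl i φ).neg.imp (Form.impl i (Form.impl i φ).neg))
  | modus_ponens {φ ψ : Form I At} (h₁ : Provable X φ) (h₂ : Provable X (φ.imp ψ)) :
      Provable X ψ
  | necessitation (i : I) {φ : Form I At} (h : Provable X φ) : Provable X (Form.impl i φ)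

/-- The formulas `a_i ⊤`. -/
def awarenessOfTop (I : Type u) (At : Type v) : Set (Form I At) :=
  {φ | ∃ i : I, φ = Form.aware i Form.top}

/-- Theorems of the Logic of Propositional Awareness. -/
def Theorem {I : Type u} {At : Type v} (φ : Form I At) : Prop := Provable (awarenessOfTop I At) φ

/-- Theorems of the Logic of Propositional Awareness without the axiom `a_i ⊤`. -/
def CoreTheorem {I : Type u} {At : Type v} (φ : Form I At) : Prop := Provable ∅ φ

/-! ### FH models and categories of FH models -/

/-- A partitional, propositionally determined FH model for `Φ`. -/
structure FHModel (I : Type u) {At : Type v} (Φ : Set At) where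
  W : Type w
  nonempty : Nonempty W
  R : I → W → W → Prop
  A : I → W → Set (Form I At)
  V : Φ → Set W
  awareness_subset : ∀ i w, A i w ⊆ sublanguage I Φ
  /-- Awareness is generated by primitive propositions. -/
  generated : ∀ i w, ∀ φ ∈ sublanguage I Φ,
    φ ∈ A i w ↔ ∀ p ∈ φ.atoms, Form.atom p ∈ A i w
  /-- Agents know what they are aware of. -/
  know_awareness : ∀ i w t, R i w t → A i w = A i t
  partitional : ∀ i, Equivalence (R i)

/-- Satisfaction in an FH model for `Φ`. It is meaningful for formulas of the sublanguage for `Φ`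
and is only used for those. -/
def FHModel.Sat {I : Type u} {At : Type v} {Φ : Set At} (K : FHModel.{u, v, w} I Φ) :
    Form I At → K.W → Prop
  | .top, _ => True
  | .atom p, x => ∃ h : p ∈ Φ, x ∈ K.V ⟨p, h⟩
  | .neg φ, x => ¬ K.Sat φ x
  | .and φ ψ, x => K.Sat φ x ∧ K.Sat ψ x
  | .impl i φ, x => ∀ t, K.R i x t → K.Sat φ t
  | .aware i φ, x => φ ∈ K.A i x
  | .expl i φ, x => (∀ t, K.R i x t → K.Sat φ t) ∧ φ ∈ K.A i x

/-- Surjective bounded morphisms of FH models, for `Ψ ⊆ Φ`. -/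
structure IsSurjectiveBoundedMorphism {I : Type u} {At : Type v} {Φ Ψ : Set At} (h : Ψ ⊆ Φ)
    (K : FHModel.{u, v, w} I Φ) (K' : FHModel.{u, v, w} I Ψ) (f : K.W → K'.W) : Prop where
  surjective : Function.Surjective f
  atomic_harmony : ∀ (p : At) (hp : p ∈ Ψ) (x : K.W), x ∈ K.V ⟨p, h hp⟩ ↔ f x ∈ K'.V ⟨p, hp⟩
  awareness_consistency : ∀ i x, K.A i x ∩ sublanguage I Ψ = K'.A i (f x)
  homomorphism : ∀ i x t, K.R i x t → K'.R i (f x) (f t)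
  back : ∀ i x t', K'.R i (f x) t' → ∃ t, f t = t' ∧ K.R i x t

/-- A category of FH models: one FH model for each set of atoms, with a commuting system of
surjective bounded morphisms. -/
structure FHCategory (I : Type u) (At : Type v) where
  K : ∀ Φ : Set At, FHModel.{u, v, w} I Φ
  f : ∀ {Φ Ψ : Set At}, Ψ ⊆ Φ → (K Φ).W → (K Ψ).W
  morphism : ∀ {Φ Ψ : Set At} (h : Ψ ⊆ Φ), IsSurjectiveBoundedMorphism h (K Φ) (K Ψ) (f h)
  f_id : ∀ (Φ : Set At) (x : (K Φ).W), f (Set.Subset.refl Φ) x = x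
  f_comp : ∀ {Φ Ψ Υ : Set At} (h₁ : Υ ⊆ Ψ) (h₂ : Ψ ⊆ Φ) (x : (K Φ).W),
    f (h₁.trans h₂) x = f h₁ (f h₂ x)

/-- Validity in a category of FH models: truth at all states of all FH models in the category in
which the formula is defined. -/
def FHCategory.Valid {I : Type u} {At : Type v} (C : FHCategory.{u, v, w} I At)
    (φ : Form I At) : Prop :=
  ∀ Φ : Set At, φ.atoms ⊆ Φ → ∀ x : (C.K Φ).W, (C.K Φ).Sat φ x

/-! ### HMS models -/

/-- A projective lattice of non-empty state spaces indexed by the subsets of `At`. -/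
structure SpaceLattice (At : Type v) where
  S : Set At → Type w
  nonempty : ∀ Φ, Nonempty (S Φ)
  r : ∀ {Φ Ψ : Set At}, Ψ ⊆ Φ → S Φ → S Ψ
  r_surjective : ∀ {Φ Ψ : Set At} (h : Ψ ⊆ Φ), Function.Surjective (r h)
  r_id : ∀ (Φ : Set At) (s : S Φ), r (Set.Subset.refl Φ) s = s
  r_comp : ∀ {Φ Ψ Υ : Set At} (h₁ : Υ ⊆ Ψ) (h₂ : Ψ ⊆ Φ) (s : S Φ),
    r (h₁.trans h₂) s = r h₁ (r h₂ s)

namespace SpaceLattice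

variable {At : Type v} (L : SpaceLattice.{v, w} At)

/-- The disjoint union of all state spaces; the first component of a state is the index of its
space. -/
abbrev State : Type (max v w) := Σ Φ : Set At, L.S Φ

/-- The space `S_Φ` as a set of states. -/
def space (Φ : Set At) : Set L.State := {ω | ω.1 = Φ}

/-- The projection of a state to `S_Ψ`. -/
def proj (ω : L.State) (Ψ : Set At) (h : Ψ ⊆ ω.1) : L.State := ⟨Ψ, L.r h ω.2⟩

/-- The projection of a set of states to `S_Ψ`. -/
def projSet (D : Set L.State) (Ψ : Set At) : Set L.State :=
  {ω | ∃ ω' ∈ D, ∃ h : Ψ ⊆ ω'.1, ω = L.proj ω' Ψ h}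

/-- For a subset `D` of one space, the set of all states whose projection to that space exists and
lies in `D`. -/
def up (D : Set L.State) : Set L.State :=
  {ω | ∃ (Φ : Set At) (h : Φ ⊆ ω.1), L.proj ω Φ h ∈ D}

/-- An event, given by its base-space and its base (so that the empty events with different
base-spaces are distinguished). -/
structure Event where
  baseSpace : Set At
  base : Set L.State
  base_subset : base ⊆ L.space baseSpace

variable {L}

/-- The set of states in an event. -/
def Event.toSet (E : L.Event) : Set L.State := L.up E.base

/-- The set of states in the negation of an event. -/
def Event.negSet (E : L.Event) : Set L.State := L.up (L.space E.baseSpace \ E.base)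

/-- The index of the base-space of the event `[φ]`. The base-space of an intersection is the join
of the base-spaces; negation and the epistemic operators keep the base-space. -/
def baseSpaceOf {I : Type u} (val : At → L.Event) : Form I At → Set At
  | .top => ∅
  | .atom p => (val p).baseSpace
  | .neg φ => baseSpaceOf val φ
  | .and φ ψ => baseSpaceOf val φ ∪ baseSpaceOf val ψ
  | .impl _ φ => baseSpaceOf val φ
  | .aware _ φ => baseSpaceOf val φ
  | .expl _ φ => baseSpaceOf val φ

/-- The set `[φ]` of states at which `φ` is satisfied, for a valuation `val`, implicit and explicit
possibility correspondences `Lam` and `Pi`, and awareness levels, where `aw i ω Φ` says that the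
awareness level of `i` at `ω` is at least `S_Φ`. -/
def truthSet {I : Type u} (val : At → L.Event) (Lam Pi : I → L.State → Set L.State)
    (aw : I → L.State → Set At → Prop) : Form I At → Set L.State
  | .top => Set.univ
  | .atom p => (val p).toSet
  | .neg φ => L.up (L.space (baseSpaceOf val φ) \ truthSet val Lam Pi aw φ)
  | .and φ ψ => truthSet val Lam Pi aw φ ∩ truthSet val Lam Pi aw ψ
  | .impl i φ => {ω | Lam i ω ⊆ truthSet val Lam Pi aw φ}
  | .aware i φ => {ω | aw i ω (baseSpaceOf val φ)}
  | .expl i φ => {ω | Pi i ω ⊆ truthSet val Lam Pi aw φ}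

/-- The formula `φ` is defined at the state `ω`. -/
def DefinedAt {I : Type u} (val : At → L.Event) (φ : Form I At) (ω : L.State) : Prop :=
  ∀ p ∈ φ.atoms, ω ∈ (val p).toSet ∪ (val p).negSet

end SpaceLattice

/-- An HMS model. -/
structure HMSModel (I : Type u) (At : Type v) extends SpaceLattice.{v, w} At where
  Pi : I → toSpaceLattice.State → Set toSpaceLattice.State
  val : At → toSpaceLattice.Event
  Pi_nonempty : ∀ i ω, (Pi i ω).Nonempty
  confinement : ∀ i ω, ∃ Ψ ⊆ ω.1, Pi i ω ⊆ toSpaceLattice.space Ψ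
  generalized_reflexivity : ∀ i ω, ω ∈ toSpaceLattice.up (Pi i ω)
  stationarity : ∀ i ω, ∀ ω' ∈ Pi i ω, Pi i ω' = Pi i ω
  projections_preserve_ignorance : ∀ i ω (Ψ : Set At) (h : Ψ ⊆ ω.1),
    toSpaceLattice.up (Pi i ω) ⊆ toSpaceLattice.up (Pi i (toSpaceLattice.proj ω Ψ h))
  projections_preserve_knowledge : ∀ i ω (Ψ Υ : Set At) (h₁ : Υ ⊆ Ψ) (h₂ : Ψ ⊆ ω.1),
    Pi i ω ⊆ toSpaceLattice.space Ψ →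
      toSpaceLattice.projSet (Pi i ω) Υ = Pi i (toSpaceLattice.proj ω Υ (h₁.trans h₂))

/-- Reflexivity, Stationarity and Projections Preserve Implicit Knowledge, for an implicit
possibility correspondence. -/
structure IsImplicitCorrespondence {At : Type v} (L : SpaceLattice.{v, w} At)
    (Lam : L.State → Set L.State) : Prop where
  reflexivity : ∀ ω, ω ∈ Lam ω
  stationarity : ∀ ω, ∀ ω' ∈ Lam ω, Lam ω' = Lam ω
  projections_preserve : ∀ ω (Ψ : Set At) (h : Ψ ⊆ ω.1),
    L.projSet (Lam ω) Ψ = Lam (L.proj ω Ψ h)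

/-- A complemented HMS model. -/
structure ComplementedHMSModel (I : Type u) (At : Type v) extends HMSModel.{u, v, w} I At where
  Lam : I → toSpaceLattice.State → Set toSpaceLattice.State
  implicit : ∀ i, IsImplicitCorrespondence toSpaceLattice (Lam i)
  explicit_measurability : ∀ i ω, ∀ ω' ∈ Lam i ω, Pi i ω' = Pi i ω
  /-- Here `S_Ψ` is the space that contains `Pi i ω`. -/
  implicit_measurability : ∀ i ω (Ψ : Set At), Pi i ω ⊆ toSpaceLattice.space Ψ →
    ∀ ω' ∈ Pi i ω, Lam i ω' = toSpaceLattice.projSet (Lam i ω) Ψ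

namespace ComplementedHMSModel

variable {I : Type u} {At : Type v} (M : ComplementedHMSModel.{u, v, w} I At)

/-- The space that contains `Pi i ω` is at least as expressive as `S_Φ`. -/
def AwareOf (i : I) (ω : M.State) (Φ : Set At) : Prop :=
  ∃ Ψ : Set At, M.Pi i ω ⊆ M.space Ψ ∧ Φ ⊆ Ψ

/-- Satisfaction in a complemented HMS model. -/
def Sat (ω : M.State) (φ : Form I At) : Prop :=
  ω ∈ SpaceLattice.truthSet M.val M.Lam M.Pi M.AwareOf φ

/-- Validity: truth at all states at which the formula is defined. -/
def Valid (φ : Form I At) : Prop :=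
  ∀ ω : M.State, SpaceLattice.DefinedAt M.val φ ω → M.Sat ω φ

end ComplementedHMSModel

/-- An implicit knowledge-based HMS model. The awareness level `S_Φ` is represented by `Φ`. -/
structure ImplicitHMSModel (I : Type u) (At : Type v) extends SpaceLattice.{v, w} At where
  Lam : I → toSpaceLattice.State → Set toSpaceLattice.State
  α : I → toSpaceLattice.State → Set At
  val : At → toSpaceLattice.Event
  Lam_nonempty : ∀ i ω, (Lam i ω).Nonempty
  implicit : ∀ i, IsImplicitCorrespondence toSpaceLattice (Lam i)
  lack_of_conception : ∀ i ω, α i ω ⊆ ω.1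
  awareness_measurability : ∀ i ω, ∀ ω' ∈ Lam i ω, α i ω' = α i ω
  awareness_below : ∀ i ω (Ψ : Set At) (h : Ψ ⊆ α i ω),
    α i (toSpaceLattice.proj ω Ψ (h.trans (lack_of_conception i ω))) = Ψ
  awareness_above : ∀ i ω (Ψ : Set At) (h : Ψ ⊆ ω.1), α i ω ⊆ Ψ →
    α i (toSpaceLattice.proj ω Ψ h) = α i ω
  awareness_mono : ∀ i ω (Ψ : Set At) (h : Ψ ⊆ ω.1),
    α i (toSpaceLattice.proj ω Ψ h) ⊆ α i ω

namespace ImplicitHMSModel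

variable {I : Type u} {At : Type v} (M : ImplicitHMSModel.{u, v, w} I At)

/-- The derived explicit possibility correspondence. -/
def derivedPi (i : I) (ω : M.State) : Set M.State := M.projSet (M.Lam i ω) (M.α i ω)

/-- Satisfaction in an implicit knowledge-based HMS model. -/
def Sat (ω : M.State) (φ : Form I At) : Prop :=
  ω ∈ SpaceLattice.truthSet M.val M.Lam M.derivedPi (fun i ω Φ => Φ ⊆ M.α i ω) φ

/-- Validity: truth at all states at which the formula is defined. -/
def Valid (φ : Form I At) : Prop :=
  ∀ ω : M.State, SpaceLattice.DefinedAt M.val φ ω → M.Sat ω φ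

end ImplicitHMSModel

/-! ### Validity in the three classes, soundness and completeness -/

/-- Validity in the class of categories of FH models. -/
def ValidInFHCategories {I : Type u} {At : Type v} (φ : Form I At) : Prop :=
  ∀ C : FHCategory.{u, v, w} I At, C.Valid φ

/-- Validity in the class of complemented HMS models. -/
def ValidInComplementedHMS {I : Type u} {At : Type v} (φ : Form I At) : Prop :=
  ∀ M : ComplementedHMSModel.{u, v, w} I At, M.Valid φ

/-- Validity in the class of implicit knowledge-based HMS models. -/
def ValidInImplicitHMS {I : Type u} {At : Type v} (φ : Form I At) : Prop :=
  ∀ M : ImplicitHMSModel.{u, v, w} I At, M.Valid φ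

/-- Every theorem in the language is valid. -/
def Sound {I : Type u} {At : Type v} (language : Set (Form I At)) (thm valid : Form I At → Prop) :
    Prop :=
  ∀ φ ∈ language, thm φ → valid φ

/-- Every valid formula of the language is a theorem. -/
def Complete {I : Type u} {At : Type v} (language : Set (Form I At))
    (thm valid : Form I At → Prop) : Prop :=
  ∀ φ ∈ language, valid φ → thm φ

/-- Soundness and completeness for a language with respect to each of the three classes. -/
def SoundAndCompleteForAllClasses {I : Type u} {At : Type v} (language : Set (Form I At))
    (thm : Form I At → Prop) : Prop :=
  (Sound language thm ValidInFHCategories.{u, v, w} ∧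
    Complete language thm ValidInFHCategories.{u, v, w}) ∧
  (Sound language thm ValidInComplementedHMS.{u, v, w} ∧
    Complete language thm ValidInComplementedHMS.{u, v, w}) ∧
  (Sound language thm ValidInImplicitHMS.{u, v, w} ∧
    Complete language thm ValidInImplicitHMS.{u, v, w})

end LPA

/-! Soundness. A derivation of `φ` may pass through atoms foreign to `φ`, so theorems are checked
only in models for all atoms, where every formula is defined (`FHModel.sat_of_theorem`). Truth then
moves down: in a category of FH models along the surjective bounded morphisms, which preserve truth;
in an implicit knowledge-based HMS model along the projections, because truth sets are invariant
above their base-space (`sat_invariant`) and the most expressive space is itself an FH model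
(`topFHModel`). Complemented HMS models need no separate argument: `Π` is `Λ` projected to the
awareness level, and that level is the space containing `Π`, so the two kinds of HMS model are
interdefinable and validate the same formulas.

Completeness. Maximal consistent sets form one canonical frame. T, 4 and 5 make accessibility an
equivalence, and the introspection axioms make awareness constant on its classes. The canonical
category and the canonical HMS model place a copy of this frame at every `Φ`, with identity maps,
and cut awareness down to `Φ`.

The axiom `a_i ⊤` matters only in `IsMaxConsistent.aware_mem`: awareness of `φ` reduces to awareness
of its atoms by the other axioms unless `⊤` occurs in `φ`. Hence one argument, with the extra axioms
`X` as a parameter, covers both logics. -/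

namespace LPA

/-! ### Propositional reasoning and maximal consistent sets -/

/-- Material implication of propositional formulas. -/
def PForm.imp (s t : PForm) : PForm := .neg (.and s (.neg t))

/-- The substitution that sends the first three variables to given formulas. -/
def threeVars {I : Type u} {At : Type v} (a b c : Form I At) : ℕ → Form I At
  | 0 => a
  | 1 => b
  | _ => c

section Derivations

variable {I : Type u} {At : Type v} {X : Set (Form I At)}

theorem Provable.mono {X Y : Set (Form I At)} (hXY : X ⊆ Y) {φ : Form I At}
    (h : Provable X φ) : Provable Y φ := by
  induction h with
  | extra h => exact .extra (hXY h)
  | taut t ht σ => exact .taut t ht σ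
  | distribution i φ ψ => exact .distribution i φ ψ
  | explicit i φ => exact .explicit i φ
  | aware_and i φ ψ => exact .aware_and i φ ψ
  | aware_neg i φ => exact .aware_neg i φ
  | aware_expl i j φ => exact .aware_expl i j φ
  | aware_aware i j φ => exact .aware_aware i j φ
  | aware_impl i j φ => exact .aware_impl i j φ
  | awareness_introspection i φ => exact .awareness_introspection i φ
  | unawareness_introspection i φ => exact .unawareness_introspection i φ
  | truth i φ => exact .truth i φ
  | positive_introspection i φ => exact .positive_introspection i φ
  | negative_introspection i φ => exact .negative_introspection i φ
  | modus_ponens _ _ ih₁ ih₂ => exact .modus_ponens ih₁ ih₂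
  | necessitation i _ ih => exact .necessitation i ih

theorem Provable.weaken (a b : Form I At) : Provable X (a.imp (b.imp a)) :=
  .taut (.imp (.var 0) (.imp (.var 1) (.var 0)))
    (fun e => by simp only [PForm.imp, PForm.eval]; tauto) (threeVars a b a)

theorem Provable.imp_self (a : Form I At) : Provable X (a.imp a) :=
  .taut (.imp (.var 0) (.var 0))
    (fun e => by simp only [PForm.imp, PForm.eval]; tauto) (threeVars a a a)

theorem Provable.imp_distrib (a b c : Form I At) :
    Provable X ((a.imp (b.imp c)).imp ((a.imp b).imp (a.imp c))) :=
  .taut (.imp (.imp (.var 0) (.imp (.var 1) (.var 2)))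
      (.imp (.imp (.var 0) (.var 1)) (.imp (.var 0) (.var 2))))
    (fun e => by simp only [PForm.imp, PForm.eval]; tauto) (threeVars a b c)

theorem Provable.explosion (a b : Form I At) : Provable X (a.imp (a.neg.imp b)) :=
  .taut (.imp (.var 0) (.imp (.neg (.var 0)) (.var 1)))
    (fun e => by simp only [PForm.imp, PForm.eval]; tauto) (threeVars a b a)

theorem Provable.cases (a b : Form I At) :
    Provable X ((a.imp b).imp ((a.neg.imp b).imp b)) :=
  .taut (.imp (.imp (.var 0) (.var 1)) (.imp (.imp (.neg (.var 0)) (.var 1)) (.var 1)))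
    (fun e => by simp only [PForm.imp, PForm.eval]; tauto) (threeVars a b a)

theorem Provable.and_intro (a b : Form I At) : Provable X (a.imp (b.imp (a.and b))) :=
  .taut (.imp (.var 0) (.imp (.var 1) (.and (.var 0) (.var 1))))
    (fun e => by simp only [PForm.imp, PForm.eval]; tauto) (threeVars a b a)

theorem Provable.and_left (a b : Form I At) : Provable X ((a.and b).imp a) :=
  .taut (.imp (.and (.var 0) (.var 1)) (.var 0))
    (fun e => by simp only [PForm.imp, PForm.eval]; tauto) (threeVars a b a)

theorem Provable.and_right (a b : Form I At) : Provable X ((a.and b).imp b) :=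
  .taut (.imp (.and (.var 0) (.var 1)) (.var 1))
    (fun e => by simp only [PForm.imp, PForm.eval]; tauto) (threeVars a b a)

theorem Provable.top : Provable X Form.top :=
  .taut .top (fun _ => trivial) (fun _ => Form.top)

/-- Derivability from a set of premises, by modus ponens only. -/
inductive Deriv (X Γ : Set (Form I At)) : Form I At → Prop
  | thm {φ : Form I At} (h : Provable X φ) : Deriv X Γ φ
  | hyp {φ : Form I At} (h : φ ∈ Γ) : Deriv X Γ φ
  | mp {φ ψ : Form I At} (h₁ : Deriv X Γ φ) (h₂ : Deriv X Γ (φ.imp ψ)) : Deriv X Γ ψ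

theorem Deriv.provable {φ : Form I At} (h : Deriv X ∅ φ) : Provable X φ := by
  induction h with
  | thm h => exact h
  | hyp h => exact absurd h (Set.notMem_empty _)
  | mp _ _ ih₁ ih₂ => exact .modus_ponens ih₁ ih₂

/-- The deduction theorem. -/
theorem Deriv.deduction {Γ : Set (Form I At)} {φ ψ : Form I At}
    (h : Deriv X (insert φ Γ) ψ) : Deriv X Γ (φ.imp ψ) := by
  induction h with
  | thm h => exact .mp (.thm h) (.thm (.weaken _ _))
  | hyp h =>
    rcases h with rfl | h
    · exact .thm (.imp_self _)
    · exact .mp (.hyp h) (.thm (.weaken _ _))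
  | mp _ _ ih₁ ih₂ => exact .mp ih₁ (.mp ih₂ (.thm (.imp_distrib _ _ _)))

theorem Deriv.mono {Γ Δ : Set (Form I At)} (hΓ : Γ ⊆ Δ) {φ : Form I At}
    (h : Deriv X Γ φ) : Deriv X Δ φ := by
  induction h with
  | thm h => exact .thm h
  | hyp h => exact .hyp (hΓ h)
  | mp _ _ ih₁ ih₂ => exact .mp ih₁ ih₂

/-- A derivation from the union of a chain uses only one member of the chain. -/
theorem Deriv.of_sUnion {c : Set (Set (Form I At))} (hc : IsChain (· ⊆ ·) c) (hne : c.Nonempty)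
    {φ : Form I At} (h : Deriv X (⋃₀ c) φ) : ∃ Γ ∈ c, Deriv X Γ φ := by
  induction h with
  | thm h => exact hne.imp fun Γ hΓ => ⟨hΓ, .thm h⟩
  | hyp h =>
    obtain ⟨Γ, hΓ, h⟩ := h
    exact ⟨Γ, hΓ, .hyp h⟩
  | mp _ _ ih₁ ih₂ =>
    obtain ⟨Γ, hΓ, h₁⟩ := ih₁
    obtain ⟨Δ, hΔ, h₂⟩ := ih₂
    rcases hc.total hΓ hΔ with hle | hle
    · exact ⟨Δ, hΔ, .mp (h₁.mono hle) h₂⟩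
    · exact ⟨Γ, hΓ, .mp h₁ (h₂.mono hle)⟩

/-- Maximal consistent sets: deductively closed sets that decide every formula. -/
structure IsMaxConsistent (X Δ : Set (Form I At)) : Prop where
  closed : ∀ {φ}, Deriv X Δ φ → φ ∈ Δ
  neg_mem : ∀ {φ : Form I At}, φ.neg ∈ Δ ↔ φ ∉ Δ

/-- Lindenbaum's lemma. -/
theorem exists_isMaxConsistent {Γ : Set (Form I At)} {φ : Form I At} (h : ¬ Deriv X Γ φ) :
    ∃ Δ, IsMaxConsistent X Δ ∧ Γ ⊆ Δ ∧ φ ∉ Δ := by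
  -- Maximality is among the sets that do not derive `φ`, so that `φ ∉ Δ` is built in.
  obtain ⟨Δ, hΓΔ, hmax⟩ := zorn_subset_nonempty {Δ : Set (Form I At) | ¬ Deriv X Δ φ}
    (fun c hcS hc hne => ⟨⋃₀ c, fun hd => by
      obtain ⟨Γ', hΓ', hd'⟩ := hd.of_sUnion hc hne
      exact hcS hΓ' hd', fun _ hs => Set.subset_sUnion_of_mem hs⟩) Γ h
  have hφ : ¬ Deriv X Δ φ := hmax.prop
  -- By maximality, adding a missing `ψ` makes `φ` derivable, and the deduction theorem applies.
  -- Every failure of closure or of deciding a formula then leads to a derivation of `φ`.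
  have key : ∀ {ψ}, ψ ∉ Δ → Deriv X Δ (ψ.imp φ) := fun {ψ} hψ => by
    by_contra hcon
    have hins : ¬ Deriv X (insert ψ Δ) φ := fun hd => hcon hd.deduction
    exact hψ (hmax.le_of_ge hins (Set.subset_insert _ _) (Set.mem_insert _ _))
  refine ⟨Δ, ⟨fun {ψ} hψ => ?_, fun {ψ} => ⟨fun hn hp => ?_, fun hp => ?_⟩⟩, hΓΔ,
    fun hmem => hφ (.hyp hmem)⟩
  · by_contra hmem
    exact hφ (.mp hψ (key hmem))
  · exact hφ (.mp (.hyp hn) (.mp (.hyp hp) (.thm (.explosion _ _))))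
  · by_contra hn
    exact hφ (.mp (key hn) (.mp (key hp) (.thm (.cases _ _))))

namespace IsMaxConsistent

variable {Δ : Set (Form I At)}

theorem mem_of_provable (hΔ : IsMaxConsistent X Δ) {φ : Form I At} (h : Provable X φ) : φ ∈ Δ :=
  hΔ.closed (.thm h)

theorem and_mem (hΔ : IsMaxConsistent X Δ) {φ ψ : Form I At} :
    φ.and ψ ∈ Δ ↔ φ ∈ Δ ∧ ψ ∈ Δ :=
  ⟨fun h => ⟨hΔ.closed (.mp (.hyp h) (.thm (.and_left _ _))),
    hΔ.closed (.mp (.hyp h) (.thm (.and_right _ _)))⟩,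
  fun h => hΔ.closed (.mp (.hyp h.2) (.mp (.hyp h.1) (.thm (.and_intro _ _))))⟩

theorem imp_mem (hΔ : IsMaxConsistent X Δ) {φ ψ : Form I At} :
    φ.imp ψ ∈ Δ ↔ (φ ∈ Δ → ψ ∈ Δ) := by
  rw [Form.imp, hΔ.neg_mem, hΔ.and_mem, hΔ.neg_mem]
  tauto

theorem mem_of_imp (hΔ : IsMaxConsistent X Δ) {φ ψ : Form I At} (h : Provable X (φ.imp ψ))
    (hφ : φ ∈ Δ) : ψ ∈ Δ :=
  hΔ.imp_mem.1 (hΔ.mem_of_provable h) hφ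

theorem mem_congr (hΔ : IsMaxConsistent X Δ) {φ ψ : Form I At} (h : Provable X (φ.iff ψ)) :
    φ ∈ Δ ↔ ψ ∈ Δ := by
  have := hΔ.mem_of_provable h
  rw [Form.iff, hΔ.and_mem, hΔ.imp_mem, hΔ.imp_mem] at this
  exact ⟨this.1, this.2⟩

/-- Awareness is propositionally determined, as soon as the formula does not contain `⊤` or
awareness of `⊤` is provable. -/
theorem aware_mem (hΔ : IsMaxConsistent X Δ) {φ : Form I At}
    (hφ : φ.TopFree ∨ awarenessOfTop I At ⊆ X) (i : I) :
    Form.aware i φ ∈ Δ ↔ ∀ p ∈ φ.atoms, Form.aware i (Form.atom p) ∈ Δ := by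
  induction φ with
  | top =>
    -- `⊤` has no atoms, so the right-hand side is vacuous and the left-hand side is the axiom `a_i
    -- ⊤`. No other case needs it.
    have hX : awarenessOfTop I At ⊆ X := hφ.resolve_left id
    simp [Form.atoms, hΔ.mem_of_provable (.extra (hX ⟨i, rfl⟩))]
  | atom p => simp [Form.atoms]
  | neg φ ih => exact (hΔ.mem_congr (.aware_neg i φ)).trans (ih hφ)
  | and φ ψ ih₁ ih₂ =>
    rw [hΔ.mem_congr (.aware_and i φ ψ), hΔ.and_mem, ih₁ (hφ.imp_left And.left),
      ih₂ (hφ.imp_left And.right)]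
    simp only [Form.atoms, Set.mem_union, or_imp, forall_and]
  | impl j φ ih => exact (hΔ.mem_congr (.aware_impl i j φ)).trans (ih hφ)
  | aware j φ ih => exact (hΔ.mem_congr (.aware_aware i j φ)).trans (ih hφ)
  | expl j φ ih => exact (hΔ.mem_congr (.aware_expl i j φ)).trans (ih hφ)

theorem expl_mem (hΔ : IsMaxConsistent X Δ) {φ : Form I At} {i : I} :
    Form.expl i φ ∈ Δ ↔ Form.impl i φ ∈ Δ ∧ Form.aware i φ ∈ Δ :=
  (hΔ.mem_congr (.explicit i φ)).trans hΔ.and_mem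

end IsMaxConsistent

end Derivations

/-! ### The canonical frame -/

section Canonical

variable {I : Type u} {At : Type v}

/-- The worlds of the canonical frame: maximal consistent sets, in a universe that may be raised. -/
def CanonicalWorld (X : Set (Form I At)) : Type (max u v w) :=
  ULift.{w} {Δ : Set (Form I At) // IsMaxConsistent X Δ}

variable {X : Set (Form I At)}

namespace CanonicalWorld

/-- The formulas that belong to a world. -/
def formulas (x : CanonicalWorld.{u, v, w} X) : Set (Form I At) := x.down.1

theorem isMax (x : CanonicalWorld.{u, v, w} X) : IsMaxConsistent X x.formulas := x.down.2

/-- Canonical accessibility. -/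
def Acc (i : I) (x y : CanonicalWorld.{u, v, w} X) : Prop :=
  ∀ φ, Form.impl i φ ∈ x.formulas → φ ∈ y.formulas

/-- The atoms of which an individual is aware at a world. -/
def awareAtoms (i : I) (x : CanonicalWorld.{u, v, w} X) : Set At :=
  {p | Form.aware i (Form.atom p) ∈ x.formulas}

theorem exists_notMem {Γ : Set (Form I At)} {φ : Form I At} (h : ¬ Deriv X Γ φ) :
    ∃ x : CanonicalWorld.{u, v, w} X, Γ ⊆ x.formulas ∧ φ ∉ x.formulas := by
  obtain ⟨Δ, hΔ, h⟩ := exists_isMaxConsistent h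
  exact ⟨⟨Δ, hΔ⟩, h⟩

/-- T gives reflexivity and 4 transitivity. For symmetry, if `φ ∉ x` then `ℓφ ∉ x` by T, so `ℓ¬ℓφ ∈
x` by 5, and `¬ℓφ ∈ y`. -/
theorem acc_equivalence (i : I) : Equivalence (Acc (X := X) i) where
  refl x φ h := x.isMax.mem_of_imp (.truth i φ) h
  symm {x y} hxy φ hφ := by
    by_contra hn
    have h₁ : Form.impl i φ ∉ x.formulas := fun h => hn (x.isMax.mem_of_imp (.truth i φ) h)
    have h₂ := hxy _ (x.isMax.mem_of_imp (.negative_introspection i φ) (x.isMax.neg_mem.2 h₁))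
    exact y.isMax.neg_mem.1 h₂ hφ
  trans hxy hyz φ hφ := hyz φ (hxy _ (IsMaxConsistent.mem_of_imp (isMax _)
    (.positive_introspection i φ) hφ))

/-- Since `Deriv` applies only modus ponens to premises, `ℓ_i` can be put before every line of a
derivation: theorems by necessitation, modus ponens by distribution. -/
theorem impl_mem_of_deriv (x : CanonicalWorld.{u, v, w} X) {i : I} {φ : Form I At}
    (h : Deriv X {ψ | Form.impl i ψ ∈ x.formulas} φ) : Form.impl i φ ∈ x.formulas := by
  induction h with
  | thm h => exact x.isMax.mem_of_provable (.necessitation i h)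
  | hyp h => exact h
  | mp _ _ ih₁ ih₂ =>
    exact x.isMax.mem_of_imp (.distribution i _ _) (x.isMax.and_mem.2 ⟨ih₁, ih₂⟩)

/-- If `ℓ_i φ ∉ x`, then `φ` is not derivable from the formulas implicitly known at `x`, and
Lindenbaum's lemma extends these to an accessible world without `φ`. -/
theorem impl_mem (x : CanonicalWorld.{u, v, w} X) {i : I} {φ : Form I At} :
    Form.impl i φ ∈ x.formulas ↔ ∀ y, Acc i x y → φ ∈ y.formulas := by
  refine ⟨fun h y hxy => hxy φ h, fun h => ?_⟩
  by_contra hn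
  obtain ⟨y, hxy, hy⟩ := exists_notMem.{u, v, w} fun hd => hn (x.impl_mem_of_deriv hd)
  exact hy (h y hxy)

/-- Awareness passes to `y` by `a_i p → ℓ_i a_i p`, unawareness by `¬a_i p → ℓ_i ¬a_i p`. -/
theorem awareAtoms_eq {i : I} {x y : CanonicalWorld.{u, v, w} X} (h : Acc i x y) :
    awareAtoms i x = awareAtoms i y := by
  ext p
  refine ⟨fun hp => h _ (x.isMax.mem_of_imp (.awareness_introspection i _) hp), fun hp => ?_⟩
  by_contra hn
  exact y.isMax.neg_mem.1 (h _ (x.isMax.mem_of_imp (.unawareness_introspection i _)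
    (x.isMax.neg_mem.2 hn))) hp

theorem aware_mem (x : CanonicalWorld.{u, v, w} X) {φ : Form I At}
    (hφ : φ.TopFree ∨ awarenessOfTop I At ⊆ X) (i : I) :
    Form.aware i φ ∈ x.formulas ↔ φ.atoms ⊆ awareAtoms i x :=
  x.isMax.aware_mem hφ i

end CanonicalWorld

open CanonicalWorld

/-- The canonical FH model for a set of atoms. -/
def canonicalFHModel (hne : Nonempty (CanonicalWorld.{u, v, w} X)) (Φ : Set At) :
    FHModel.{u, v, max u v w} I Φ where
  W := CanonicalWorld.{u, v, w} X
  nonempty := hne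
  R := Acc
  -- Defined through atoms rather than by `a_i φ ∈ x`: without the axiom `a_i ⊤` a world may lack
  -- `a_i ⊤`, and then `generated` would fail at `⊤`.
  A i x := {φ | φ.atoms ⊆ Φ ∧ φ.atoms ⊆ awareAtoms i x}
  V p := {x | Form.atom p.1 ∈ x.formulas}
  awareness_subset _ _ _ h := h.1
  generated i x φ hφ := by
    refine ⟨fun h p hp => ?_, fun h => ⟨hφ, fun p hp => (h p hp).2 rfl⟩⟩
    exact ⟨Set.singleton_subset_iff.2 (h.1 hp), Set.singleton_subset_iff.2 (h.2 hp)⟩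
  know_awareness i x y h := by rw [awareAtoms_eq h]
  partitional := acc_equivalence

/-- The canonical category of FH models. -/
def canonicalFHCategory (hne : Nonempty (CanonicalWorld.{u, v, w} X)) :
    FHCategory.{u, v, max u v w} I At where
  K := canonicalFHModel hne
  f _ x := x
  morphism h :=
    { surjective := fun x => ⟨x, rfl⟩
      atomic_harmony := fun _ _ _ => Iff.rfl
      awareness_consistency := fun i x => by
        ext φ
        exact ⟨fun hφ => ⟨hφ.2, hφ.1.2⟩, fun hφ => ⟨⟨hφ.1.trans h, hφ.2⟩, hφ.1⟩⟩
      homomorphism := fun _ _ _ h => h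
      back := fun _ _ t h => ⟨t, rfl, h⟩ }
  f_id _ _ := rfl
  f_comp _ _ _ := rfl

/-- The truth lemma for the canonical FH model for all atoms. -/
theorem canonicalFHModel_sat (hne : Nonempty (CanonicalWorld.{u, v, w} X)) {φ : Form I At}
    (hφ : φ.TopFree ∨ awarenessOfTop I At ⊆ X) (x : CanonicalWorld.{u, v, w} X) :
    (canonicalFHModel hne Set.univ).Sat φ x ↔ φ ∈ x.formulas := by
  -- The only use of the condition on `⊤`; subformulas inherit it, so the induction can carry it
  -- along.
  have hA : ∀ {ψ : Form I At} (_ : ψ.TopFree ∨ awarenessOfTop I At ⊆ X) (i : I)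
      (y : CanonicalWorld.{u, v, w} X),
      ψ ∈ (canonicalFHModel hne Set.univ).A i y ↔ Form.aware i ψ ∈ y.formulas :=
    fun hψ i y => (and_iff_right (Set.subset_univ _)).trans (y.aware_mem hψ i).symm
  induction φ generalizing x with
  | top => exact iff_of_true trivial (x.isMax.mem_of_provable .top)
  | atom p => exact ⟨fun h => h.2, fun h => ⟨Set.mem_univ p, h⟩⟩
  | neg φ ih => exact (not_congr (ih hφ x)).trans x.isMax.neg_mem.symm
  | and φ ψ ih₁ ih₂ =>
    exact (and_congr (ih₁ (hφ.imp_left And.left) x) (ih₂ (hφ.imp_left And.right) x)).trans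
      x.isMax.and_mem.symm
  | impl i φ ih =>
    exact (forall_congr' fun y => imp_congr_right fun _ => ih hφ y).trans x.impl_mem.symm
  | aware i φ => exact hA (ψ := φ) hφ i x
  | expl i φ ih =>
    exact (and_congr ((forall_congr' fun y => imp_congr_right fun _ => ih hφ y).trans
      x.impl_mem.symm) (hA (ψ := φ) hφ i x)).trans x.isMax.expl_mem.symm

theorem provable_of_validInFHCategories {φ : Form I At}
    (hφ : φ.TopFree ∨ awarenessOfTop I At ⊆ X)
    (h : ValidInFHCategories.{u, v, max u v w} φ) : Provable X φ := by
  by_contra hn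
  -- The refuting world also supplies the non-emptiness of the canonical frame.
  obtain ⟨x, -, hx⟩ := exists_notMem.{u, v, w} fun hd : Deriv X ∅ φ => hn hd.provable
  exact hx ((canonicalFHModel_sat ⟨x⟩ hφ x).1
    (h (canonicalFHCategory ⟨x⟩) Set.univ (Set.subset_univ _) x))

end Canonical

/-! ### Soundness for FH models and for categories of FH models -/

section FHSoundness

variable {I : Type u} {At : Type v}

theorem FHModel.sat_imp {Φ : Set At} (K : FHModel.{u, v, w} I Φ) (φ ψ : Form I At) (x : K.W) :
    K.Sat (φ.imp ψ) x ↔ (K.Sat φ x → K.Sat ψ x) := by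
  simp only [Form.imp, FHModel.Sat]
  tauto

theorem FHModel.sat_iff {Φ : Set At} (K : FHModel.{u, v, w} I Φ) (φ ψ : Form I At) (x : K.W) :
    K.Sat (φ.iff ψ) x ↔ (K.Sat φ x ↔ K.Sat ψ x) := by
  rw [Form.iff, FHModel.Sat, K.sat_imp, K.sat_imp]
  exact iff_def.symm

theorem FHModel.sat_subst {Φ : Set At} (K : FHModel.{u, v, w} I Φ) (t : PForm)
    (σ : ℕ → Form I At) (x : K.W) :
    K.Sat (t.subst σ) x ↔ t.eval fun n => K.Sat (σ n) x := by
  induction t with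
  | top => exact Iff.rfl
  | var n => exact Iff.rfl
  | neg t ih => exact not_congr ih
  | and s t ih₁ ih₂ => exact and_congr ih₁ ih₂

theorem FHModel.mem_A_iff (K : FHModel.{u, v, w} I (Set.univ : Set At)) {i : I} {x : K.W}
    {φ : Form I At} : φ ∈ K.A i x ↔ ∀ p ∈ φ.atoms, Form.atom p ∈ K.A i x :=
  K.generated i x φ (Set.subset_univ _)

/-- Theorems hold at every state of an FH model for all atoms. -/
theorem FHModel.sat_of_theorem (K : FHModel.{u, v, w} I (Set.univ : Set At)) {φ : Form I At}
    (h : Theorem φ) (x : K.W) : K.Sat φ x := by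
  have congrA : ∀ {φ ψ : Form I At} (i : I) (x : K.W), φ.atoms = ψ.atoms →
      (φ ∈ K.A i x ↔ ψ ∈ K.A i x) := fun i x hat => by rw [K.mem_A_iff, K.mem_A_iff, hat]
  induction h generalizing x with
  | extra h =>
    obtain ⟨i, rfl⟩ := h
    exact K.mem_A_iff.2 fun p hp => absurd hp (Set.notMem_empty p)
  | taut t ht σ => exact (K.sat_subst t σ x).2 (ht _)
  | distribution i φ ψ =>
    rw [K.sat_imp]
    exact fun h y hy => (K.sat_imp _ _ _).1 (h.2 y hy) (h.1 y hy)
  | explicit i φ => exact (K.sat_iff _ _ _).2 Iff.rfl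
  | aware_and i φ ψ =>
    rw [K.sat_iff]
    simp only [FHModel.Sat]
    rw [K.mem_A_iff, K.mem_A_iff (φ := φ), K.mem_A_iff (φ := ψ)]
    simp only [Form.atoms, Set.mem_union, or_imp, forall_and]
  | aware_neg i φ => exact (K.sat_iff _ _ _).2 (congrA i x rfl)
  | aware_expl i j φ => exact (K.sat_iff _ _ _).2 (congrA i x rfl)
  | aware_aware i j φ => exact (K.sat_iff _ _ _).2 (congrA i x rfl)
  | aware_impl i j φ => exact (K.sat_iff _ _ _).2 (congrA i x rfl)
  | awareness_introspection i φ =>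
    rw [K.sat_imp]
    intro h y hy
    simp only [FHModel.Sat] at h ⊢
    rwa [← K.know_awareness i x y hy]
  | unawareness_introspection i φ =>
    rw [K.sat_imp]
    intro h y hy
    simp only [FHModel.Sat] at h ⊢
    rwa [← K.know_awareness i x y hy]
  | truth i φ => exact (K.sat_imp _ _ _).2 fun h => h x ((K.partitional i).refl x)
  | positive_introspection i φ =>
    exact (K.sat_imp _ _ _).2 fun h y hy z hz => h z ((K.partitional i).trans hy hz)
  | negative_introspection i φ =>
    exact (K.sat_imp _ _ _).2 fun h y hy hyφ =>
      h fun z hz => hyφ z ((K.partitional i).trans ((K.partitional i).symm hy) hz)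
  | modus_ponens _ _ ih₁ ih₂ => exact (K.sat_imp _ _ _).1 (ih₂ x) (ih₁ x)
  | necessitation i _ ih => exact fun y _ => ih y

/-- Surjective bounded morphisms preserve the truth of the formulas of the smaller language. -/
theorem IsSurjectiveBoundedMorphism.sat_iff {Φ Ψ : Set At} {h : Ψ ⊆ Φ}
    {K : FHModel.{u, v, w} I Φ} {K' : FHModel.{u, v, w} I Ψ} {f : K.W → K'.W}
    (hf : IsSurjectiveBoundedMorphism h K K' f) {φ : Form I At} (hφ : φ.atoms ⊆ Ψ) (x : K.W) :
    K.Sat φ x ↔ K'.Sat φ (f x) := by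
  have hA : ∀ {ψ : Form I At} (_ : ψ.atoms ⊆ Ψ) (i : I) (y : K.W),
      ψ ∈ K.A i y ↔ ψ ∈ K'.A i (f y) := fun hψ i y => by
    rw [← hf.awareness_consistency i y]
    exact (and_iff_left hψ).symm
  have hbox : ∀ {ψ : Form I At} (i : I) (y : K.W), (∀ z, K.Sat ψ z ↔ K'.Sat ψ (f z)) →
      ((∀ z, K.R i y z → K.Sat ψ z) ↔ ∀ z, K'.R i (f y) z → K'.Sat ψ z) := fun i y hψ => by
    refine ⟨fun hy z hz => ?_, fun hy z hz => (hψ z).2 (hy _ (hf.homomorphism i y z hz))⟩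
    obtain ⟨t, rfl, ht⟩ := hf.back i y z hz
    exact (hψ t).1 (hy t ht)
  induction φ generalizing x with
  | top => exact Iff.rfl
  | atom p =>
    have hp : p ∈ Ψ := hφ rfl
    exact ⟨fun hx => ⟨hp, (hf.atomic_harmony p hp x).1 hx.2⟩,
      fun hx => ⟨h hp, (hf.atomic_harmony p hp x).2 hx.2⟩⟩
  | neg φ ih => exact not_congr (ih hφ x)
  | and φ ψ ih₁ ih₂ =>
    exact and_congr (ih₁ (Set.subset_union_left.trans hφ) x)
      (ih₂ (Set.subset_union_right.trans hφ) x)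
  | impl i φ ih => exact hbox i x (ih hφ)
  | aware i φ => exact hA (ψ := φ) hφ i x
  | expl i φ ih => exact and_congr (hbox i x (ih hφ)) (hA (ψ := φ) hφ i x)

/-- Every state for `Φ` is the image of a state for all atoms, where theorems hold, and the morphism
preserves the truth of `φ`. -/
theorem validInFHCategories_of_theorem {φ : Form I At} (h : Theorem φ) :
    ValidInFHCategories.{u, v, w} φ := by
  intro C Φ hφ x
  obtain ⟨y, rfl⟩ := (C.morphism (Set.subset_univ Φ)).surjective x
  exact ((C.morphism (Set.subset_univ Φ)).sat_iff hφ y).1 ((C.K Set.univ).sat_of_theorem h y)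

end FHSoundness

/-! ### Projections and events in a lattice of spaces -/

namespace SpaceLattice

variable {At : Type v} (L : SpaceLattice.{v, w} At)

theorem proj_proj (ω : L.State) {Ψ Υ : Set At} (h : Ψ ⊆ ω.1) (h' : Υ ⊆ Ψ) :
    L.proj (L.proj ω Ψ h) Υ h' = L.proj ω Υ (h'.trans h) :=
  Sigma.ext rfl (heq_of_eq (L.r_comp h' h ω.2).symm)

theorem proj_eq_self (ω : L.State) {Ψ : Set At} (h : Ψ = ω.1) : L.proj ω Ψ h.subset = ω := by
  subst h
  simp only [proj, L.r_id]

theorem exists_proj_eq (ω : L.State) : ∃ s : L.S Set.univ,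
    L.proj ⟨Set.univ, s⟩ ω.1 (Set.subset_univ _) = ω := by
  obtain ⟨s, hs⟩ := L.r_surjective (Set.subset_univ ω.1) ω.2
  exact ⟨s, by simp only [proj, hs]⟩

variable {L}

/-- A projection that lies in `D` lies in `S_B`, which forces the index quantified in `up`. -/
theorem mem_up {D : Set L.State} {B : Set At} (hD : D ⊆ L.space B) {ω : L.State} :
    ω ∈ L.up D ↔ ∃ h : B ⊆ ω.1, L.proj ω B h ∈ D := by
  refine ⟨fun ⟨Φ, h, hω⟩ => ?_, fun ⟨h, hω⟩ => ⟨B, h, hω⟩⟩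
  obtain rfl : Φ = B := hD hω
  exact ⟨h, hω⟩

theorem proj_mem_up {D : Set L.State} {B : Set At} (hD : D ⊆ L.space B) {ω : L.State}
    {Ψ : Set At} (hB : B ⊆ Ψ) (h : Ψ ⊆ ω.1) : L.proj ω Ψ h ∈ L.up D ↔ ω ∈ L.up D := by
  rw [mem_up hD, mem_up hD]
  have hproj := L.proj_proj ω h hB
  exact ⟨fun ⟨_, hω⟩ => ⟨hB.trans h, hproj ▸ hω⟩, fun ⟨_, hω⟩ => ⟨hB, hproj.symm ▸ hω⟩⟩

theorem baseSpaceOf_eq {I : Type u} (val : At → L.Event) (φ : Form I At) :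
    baseSpaceOf val φ = ⋃ p ∈ φ.atoms, (val p).baseSpace := by
  induction φ with
  | top => simp [baseSpaceOf, Form.atoms]
  | atom p => simp [baseSpaceOf, Form.atoms]
  | and φ ψ ih₁ ih₂ => rw [baseSpaceOf, Form.atoms, Set.biUnion_union, ih₁, ih₂]
  | neg φ ih => exact ih
  | impl i φ ih => exact ih
  | aware i φ ih => exact ih
  | expl i φ ih => exact ih

/-- A formula is defined exactly at the states at least as expressive as its base-space. -/
theorem definedAt_iff {I : Type u} {val : At → L.Event} {φ : Form I At} {ω : L.State} :
    DefinedAt val φ ω ↔ baseSpaceOf val φ ⊆ ω.1 := by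
  rw [baseSpaceOf_eq, Set.iUnion₂_subset_iff]
  refine forall₂_congr fun p _ => ?_
  rw [Set.mem_union, Event.toSet, Event.negSet, mem_up (val p).base_subset,
    mem_up Set.sdiff_subset, ← exists_or]
  refine ⟨fun ⟨h, _⟩ => h, fun h => ⟨h, ?_⟩⟩
  by_cases hω : L.proj ω _ h ∈ (val p).base
  · exact Or.inl hω
  · exact Or.inr ⟨rfl, hω⟩

end SpaceLattice

namespace IsImplicitCorrespondence

variable {At : Type v} {L : SpaceLattice.{v, w} At} {Lam : L.State → Set L.State}

/-- Confinement of `Λ` is not an axiom. It follows from (P) for the space of `ω` itself: the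
projection of `ω` there is `ω`, so `Λ(ω)` equals its own projection to that space. -/
theorem index_eq (hL : IsImplicitCorrespondence L Lam) {ω ω' : L.State} (h : ω' ∈ Lam ω) :
    ω'.1 = ω.1 := by
  have hp := hL.projections_preserve ω ω.1 subset_rfl
  rw [L.proj_eq_self ω rfl] at hp
  rw [← hp] at h
  obtain ⟨ω'', _, _, rfl⟩ := h
  rfl

theorem proj_mem (hL : IsImplicitCorrespondence L Lam) {ω ω' : L.State} (h : ω' ∈ Lam ω)
    {Ψ : Set At} (hΨ : Ψ ⊆ ω.1) (hΨ' : Ψ ⊆ ω'.1) :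
    L.proj ω' Ψ hΨ' ∈ Lam (L.proj ω Ψ hΨ) := by
  rw [← hL.projections_preserve ω Ψ hΨ]
  exact ⟨ω', h, hΨ', rfl⟩

theorem mem_comm (hL : IsImplicitCorrespondence L Lam) {ω ω' : L.State} (h : ω' ∈ Lam ω) :
    ω ∈ Lam ω' := hL.stationarity ω ω' h ▸ hL.reflexivity ω

/-- If membership in `T` is invariant under projections to spaces above `S_B`, then so is being
contained in `T` for the sets of possible states. -/
theorem subset_proj_iff (hL : IsImplicitCorrespondence L Lam) {T : Set L.State} {B : Set At}
    (hT : ∀ (ω : L.State) (Ψ : Set At) (h : Ψ ⊆ ω.1), B ⊆ Ψ → (L.proj ω Ψ h ∈ T ↔ ω ∈ T))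
    (ω : L.State) {Ψ : Set At} (h : Ψ ⊆ ω.1) (hB : B ⊆ Ψ) :
    Lam (L.proj ω Ψ h) ⊆ T ↔ Lam ω ⊆ T := by
  refine ⟨fun hsub ω' hω' => ?_, fun hsub ω' hω' => ?_⟩
  · have hΨ : Ψ ⊆ ω'.1 := h.trans (hL.index_eq hω').symm.subset
    exact (hT ω' Ψ hΨ hB).1 (hsub (hL.proj_mem hω' h hΨ))
  · rw [← hL.projections_preserve ω Ψ h] at hω'
    obtain ⟨ω'', hω'', hΨ, rfl⟩ := hω'
    exact (hT ω'' Ψ hΨ hB).2 (hsub hω'')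

end IsImplicitCorrespondence

/-! ### Implicit knowledge-based HMS models -/

namespace ImplicitHMSModel

variable {I : Type u} {At : Type v} (M : ImplicitHMSModel.{u, v, w} I At)

/-- An instance of (P), through which questions about the derived `Π` become questions about `Λ` at
a projected state. -/
theorem derivedPi_eq (i : I) (ω : M.State) :
    M.derivedPi i ω = M.Lam i (M.proj ω (M.α i ω) (M.lack_of_conception i ω)) :=
  (M.implicit i).projections_preserve ω _ _

theorem derivedPi_nonempty (i : I) (ω : M.State) : (M.derivedPi i ω).Nonempty := by
  rw [derivedPi_eq]
  exact M.Lam_nonempty i _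

theorem derivedPi_subset (i : I) (ω : M.State) : M.derivedPi i ω ⊆ M.space (M.α i ω) := by
  rintro _ ⟨ω', _, _, rfl⟩
  rfl

/-- Awareness of a level is invariant under projections to spaces above that level. -/
theorem subset_α_proj_iff (i : I) (ω : M.State) {B Ψ : Set At} (h : Ψ ⊆ ω.1) (hB : B ⊆ Ψ) :
    B ⊆ M.α i (M.proj ω Ψ h) ↔ B ⊆ M.α i ω := by
  refine ⟨fun hα => hα.trans (M.awareness_mono i ω Ψ h), fun hα => ?_⟩
  -- At `ω_B` the awareness level is `B`, and it can only grow from `ω_B` up to `ω_Ψ`.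
  have h₁ := M.awareness_below i ω B hα
  rw [← M.proj_proj ω h hB] at h₁
  exact h₁.symm.subset.trans (M.awareness_mono i (M.proj ω Ψ h) B hB)

theorem mem_neg {φ : Form I At} {ω : M.State} :
    M.Sat ω φ.neg ↔ ∃ h : SpaceLattice.baseSpaceOf M.val φ ⊆ ω.1,
      ¬ M.Sat (M.proj ω _ h) φ := by
  refine (SpaceLattice.mem_up Set.sdiff_subset).trans (exists_congr fun h => ?_)
  exact and_iff_right rfl

/-- Invariance of `φ` is a hypothesis because the induction that proves invariance uses this
equivalence. Reflexivity puts the projection of `ω` to its awareness level into `Π(ω)`, so explicit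
knowledge of `φ` forces the base-space of `φ` below that level; invariance then compares `Λ` at `ω`
and at that projection. -/
theorem sat_expl_iff_of_invariant {φ : Form I At} {i : I}
    (hB : ∀ ω : M.State, M.Sat ω φ → SpaceLattice.baseSpaceOf M.val φ ⊆ ω.1)
    (hT : ∀ (ω : M.State) (Ψ : Set At) (h : Ψ ⊆ ω.1), SpaceLattice.baseSpaceOf M.val φ ⊆ Ψ →
      (M.Sat (M.proj ω Ψ h) φ ↔ M.Sat ω φ)) (ω : M.State) :
    M.Sat ω (.expl i φ) ↔ M.Sat ω (.impl i φ) ∧ M.Sat ω (.aware i φ) := by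
  have h := (M.implicit i).subset_proj_iff hT ω (M.lack_of_conception i ω)
  have hex : M.Sat ω (.expl i φ) ↔
      M.Lam i (M.proj ω (M.α i ω) (M.lack_of_conception i ω)) ⊆ {ω | M.Sat ω φ} := by
    rw [← derivedPi_eq]
    exact Iff.rfl
  rw [hex]
  refine ⟨fun hsub => ?_, fun hsub => (h hsub.2).2 hsub.1⟩
  have hα : SpaceLattice.baseSpaceOf M.val φ ⊆ M.α i ω :=
    hB _ (hsub ((M.implicit i).reflexivity _))
  exact ⟨(h hα).1 hsub, hα⟩

/-- The truth set of a formula is a set of states above its base-space that is invariant under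
projections. -/
theorem sat_invariant (φ : Form I At) :
    (∀ ω : M.State, M.Sat ω φ → SpaceLattice.baseSpaceOf M.val φ ⊆ ω.1) ∧
    ∀ (ω : M.State) (Ψ : Set At) (h : Ψ ⊆ ω.1), SpaceLattice.baseSpaceOf M.val φ ⊆ Ψ →
      (M.Sat (M.proj ω Ψ h) φ ↔ M.Sat ω φ) := by
  induction φ with
  | top => exact ⟨fun ω _ => Set.empty_subset _, fun _ _ _ _ => Iff.rfl⟩
  | atom p =>
    exact ⟨fun ω hω => ((SpaceLattice.mem_up (M.val p).base_subset).1 hω).1,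
      fun ω Ψ h hB => SpaceLattice.proj_mem_up (M.val p).base_subset hB h⟩
  | neg φ ih =>
    exact ⟨fun ω hω => (M.mem_neg.1 hω).1,
      fun ω Ψ h hB => SpaceLattice.proj_mem_up Set.sdiff_subset hB h⟩
  | and φ ψ ih₁ ih₂ =>
    refine ⟨fun ω hω => Set.union_subset (ih₁.1 ω hω.1) (ih₂.1 ω hω.2), fun ω Ψ h hB => ?_⟩
    exact and_congr (ih₁.2 ω Ψ h (Set.subset_union_left.trans hB))
      (ih₂.2 ω Ψ h (Set.subset_union_right.trans hB))
  | impl i φ ih =>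
    exact ⟨fun ω hω => ih.1 ω (hω ((M.implicit i).reflexivity ω)),
      fun ω Ψ h hB => (M.implicit i).subset_proj_iff ih.2 ω h hB⟩
  | aware i φ ih =>
    exact ⟨fun ω hω => Set.Subset.trans hω (M.lack_of_conception i ω),
      fun ω Ψ h hB => M.subset_α_proj_iff i ω h hB⟩
  | expl i φ ih =>
    have h := M.sat_expl_iff_of_invariant (i := i) ih.1 ih.2
    refine ⟨fun ω hω => ih.1 ω (((h ω).1 hω).1 ((M.implicit i).reflexivity ω)),
      fun ω Ψ hΨ hB => ?_⟩
    rw [h, h]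
    exact and_congr ((M.implicit i).subset_proj_iff ih.2 ω hΨ hB)
      (M.subset_α_proj_iff i ω hΨ hB)

theorem sat_expl_iff {φ : Form I At} {i : I} {ω : M.State} :
    M.Sat ω (.expl i φ) ↔ M.Sat ω (.impl i φ) ∧ M.Sat ω (.aware i φ) :=
  M.sat_expl_iff_of_invariant (M.sat_invariant φ).1 (M.sat_invariant φ).2 ω

theorem sat_neg_iff {φ : Form I At} {ω : M.State} :
    M.Sat ω φ.neg ↔ SpaceLattice.baseSpaceOf M.val φ ⊆ ω.1 ∧ ¬ M.Sat ω φ := by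
  rw [M.mem_neg, ← exists_prop]
  exact exists_congr fun h => not_congr ((M.sat_invariant φ).2 ω _ h subset_rfl)

/-- The FH model on the most expressive space of an implicit knowledge-based HMS model. -/
def topFHModel : FHModel.{u, v, w} I (Set.univ : Set At) where
  W := M.S Set.univ
  nonempty := M.nonempty Set.univ
  R i x y := (⟨Set.univ, y⟩ : M.State) ∈ M.Lam i ⟨Set.univ, x⟩
  -- Base-spaces rather than atoms: the base-space of `val p` is arbitrary and need not be `S_{p}`.
  A i x := {φ | SpaceLattice.baseSpaceOf M.val φ ⊆ M.α i ⟨Set.univ, x⟩}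
  V p := {x | (⟨Set.univ, x⟩ : M.State) ∈ (M.val p).toSet}
  awareness_subset _ _ _ _ := Set.subset_univ _
  generated i x φ _ := by
    rw [Set.mem_ofPred_eq, SpaceLattice.baseSpaceOf_eq, Set.iUnion₂_subset_iff]
    exact Iff.rfl
  know_awareness i x y h := by rw [M.awareness_measurability i _ _ h]
  partitional i :=
    { refl := fun x => (M.implicit i).reflexivity _
      symm := fun h => (M.implicit i).mem_comm h
      trans := fun {x y z} h h' => by
        rw [← (M.implicit i).stationarity _ _ h]
        exact h' }

/-- In the most expressive space every formula is defined, so negation is classical, and `Λ` does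
not leave the space. -/
theorem topFHModel_sat (φ : Form I At) (x : M.S Set.univ) :
    M.topFHModel.Sat φ x ↔ M.Sat ⟨Set.univ, x⟩ φ := by
  have hbox : ∀ {ψ : Form I At} (i : I) (y : M.S Set.univ),
      (∀ z, M.topFHModel.Sat ψ z ↔ M.Sat ⟨Set.univ, z⟩ ψ) →
      ((∀ z, M.topFHModel.R i y z → M.topFHModel.Sat ψ z) ↔
        M.Sat ⟨Set.univ, y⟩ (.impl i ψ)) := fun {ψ} i y hψ => by
    refine ⟨fun h ω hω => ?_, fun h z hz => (hψ z).2 (h hz)⟩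
    obtain ⟨Φ, z⟩ := ω
    obtain rfl : Φ = Set.univ := (M.implicit i).index_eq hω
    exact (hψ z).1 (h z hω)
  induction φ generalizing x with
  | top => exact Iff.rfl
  | atom p => exact exists_prop_of_true (Set.mem_univ p)
  | neg φ ih =>
    rw [M.sat_neg_iff, and_iff_right (Set.subset_univ _)]
    exact not_congr (ih x)
  | and φ ψ ih₁ ih₂ => exact and_congr (ih₁ x) (ih₂ x)
  | impl i φ ih => exact hbox i x ih
  | aware i φ => exact Iff.rfl
  | expl i φ ih =>
    rw [M.sat_expl_iff]
    exact and_congr (hbox i x ih) Iff.rfl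

theorem valid_of_theorem {φ : Form I At} (h : Theorem φ) : M.Valid φ := by
  intro ω hω
  obtain ⟨s, hs⟩ := M.exists_proj_eq ω
  rw [← hs]
  exact ((M.sat_invariant φ).2 _ _ _ (SpaceLattice.definedAt_iff.1 hω)).2
    ((M.topFHModel_sat φ s).1 (M.topFHModel.sat_of_theorem h s))

end ImplicitHMSModel

/-! ### Translations between the two kinds of HMS models -/

section Translations

variable {I : Type u} {At : Type v}

/-- The complemented HMS model with the derived explicit possibility correspondence. -/
def ImplicitHMSModel.toComplemented (M : ImplicitHMSModel.{u, v, w} I At) :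
    ComplementedHMSModel.{u, v, w} I At where
  toSpaceLattice := M.toSpaceLattice
  Pi := M.derivedPi
  val := M.val
  Pi_nonempty := M.derivedPi_nonempty
  confinement i ω := ⟨M.α i ω, M.lack_of_conception i ω, M.derivedPi_subset i ω⟩
  generalized_reflexivity i ω :=
    ⟨_, M.lack_of_conception i ω, ω, (M.implicit i).reflexivity ω, _, rfl⟩
  stationarity i ω ω' h := by
    rw [M.derivedPi_eq i ω] at h ⊢
    -- `ω'` lies in `Λ` of `ω` projected to its awareness level, where awareness is full; so it is
    -- full at `ω'` too, and the projection that defines `Π(ω')` is trivial.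
    have hα : M.α i ω' = ω'.1 :=
      (M.awareness_measurability i _ _ h).trans ((M.awareness_below i ω _ subset_rfl).trans
        ((M.implicit i).index_eq h).symm)
    rw [M.derivedPi_eq, M.proj_eq_self ω' hα]
    exact (M.implicit i).stationarity _ _ h
  projections_preserve_ignorance i ω Ψ h := by
    rintro ω' ⟨Φ, hΦ, hω'⟩
    obtain rfl : Φ = M.α i ω := M.derivedPi_subset i ω hω'
    have hβ := M.awareness_mono i ω Ψ h
    -- The witness is the awareness level at `ω_Ψ`. It lies below that of `ω`, so (P) carries the
    -- membership down to it.
    refine ⟨_, hβ.trans hΦ, ?_⟩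
    rw [M.derivedPi_eq] at hω' ⊢
    have hmem := (M.implicit i).proj_mem hω' hβ hβ
    have h₁ := M.proj_proj ω' hΦ hβ
    have h₂ := M.proj_proj ω (M.lack_of_conception i ω) hβ
    have h₃ := M.proj_proj ω h (M.lack_of_conception i (M.proj ω Ψ h))
    rw [h₁, h₂] at hmem
    rw [h₃]
    exact hmem
  projections_preserve_knowledge i ω Ψ Υ h₁ h₂ hPi := by
    obtain ⟨ω', hω'⟩ := M.derivedPi_nonempty i ω
    -- A non-empty set of states lies in at most one space.
    obtain rfl : M.α i ω = Ψ := (M.derivedPi_subset i ω hω').symm.trans (hPi hω')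
    have hα := M.awareness_below i ω Υ h₁
    rw [M.derivedPi_eq, M.derivedPi_eq, (M.implicit i).projections_preserve _ Υ h₁,
      M.proj_proj, M.proj_eq_self (M.proj ω Υ _) hα]
  Lam := M.Lam
  implicit := M.implicit
  explicit_measurability i ω ω' h := by
    rw [ImplicitHMSModel.derivedPi, ImplicitHMSModel.derivedPi,
      (M.implicit i).stationarity ω ω' h, M.awareness_measurability i ω ω' h]
  implicit_measurability i ω Ψ hΨ ω' hω' := by
    obtain rfl : M.α i ω = Ψ := (M.derivedPi_subset i ω hω').symm.trans (hΨ hω')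
    rw [M.derivedPi_eq] at hω'
    exact ((M.implicit i).stationarity _ _ hω').trans
      ((M.implicit i).projections_preserve ω _ _).symm

theorem ImplicitHMSModel.toComplemented_awareOf (M : ImplicitHMSModel.{u, v, w} I At) :
    M.toComplemented.AwareOf = fun (i : I) (ω : M.State) Φ => Φ ⊆ M.α i ω := by
  funext i ω Φ
  refine propext ⟨fun ⟨Ψ, hΨ, hΦ⟩ => ?_, fun h => ⟨_, M.derivedPi_subset i ω, h⟩⟩
  obtain ⟨ω', hω'⟩ := M.derivedPi_nonempty i ω
  obtain rfl : M.α i ω = Ψ := (M.derivedPi_subset i ω hω').symm.trans (hΨ hω')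
  exact hΦ

theorem ImplicitHMSModel.toComplemented_valid (M : ImplicitHMSModel.{u, v, w} I At)
    {φ : Form I At} : M.toComplemented.Valid φ ↔ M.Valid φ := by
  unfold ComplementedHMSModel.Valid ComplementedHMSModel.Sat
  rw [M.toComplemented_awareOf]
  exact Iff.rfl

namespace ComplementedHMSModel

variable (M : ComplementedHMSModel.{u, v, w} I At)

/-- The index of the space that contains the explicitly possible states. -/
noncomputable def level (i : I) (ω : M.State) : Set At := (M.confinement i ω).choose

theorem level_subset (i : I) (ω : M.State) : M.level i ω ⊆ ω.1 :=
  (M.confinement i ω).choose_spec.1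

theorem Pi_subset_level (i : I) (ω : M.State) : M.Pi i ω ⊆ M.space (M.level i ω) :=
  (M.confinement i ω).choose_spec.2

theorem eq_level {i : I} {ω : M.State} {Ψ : Set At} (h : M.Pi i ω ⊆ M.space Ψ) :
    Ψ = M.level i ω := by
  obtain ⟨ω', hω'⟩ := M.Pi_nonempty i ω
  exact (h hω').symm.trans (M.Pi_subset_level i ω hω')

theorem proj_level_mem (i : I) (ω : M.State) :
    M.proj ω (M.level i ω) (M.level_subset i ω) ∈ M.Pi i ω :=
  ((SpaceLattice.mem_up (M.Pi_subset_level i ω)).1 (M.generalized_reflexivity i ω)).2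

theorem level_congr {i : I} {ω ω' : M.State} (h : M.Pi i ω' = M.Pi i ω) :
    M.level i ω' = M.level i ω :=
  M.eq_level (h ▸ M.Pi_subset_level i ω')

theorem level_below (i : I) (ω : M.State) (Ψ : Set At) (h : Ψ ⊆ M.level i ω) :
    M.level i (M.proj ω Ψ (h.trans (M.level_subset i ω))) = Ψ := by
  refine (M.eq_level ?_).symm
  rw [← M.projections_preserve_knowledge i ω _ Ψ h (M.level_subset i ω) (M.Pi_subset_level i ω)]
  rintro _ ⟨ω', _, _, rfl⟩
  rfl

/-- The projection of `ω` to its level lies in the upset of `Π(ω)`, hence in that of `Π(ω_Ψ)`, whose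
states all lie above the level of `ω_Ψ`. -/
theorem level_mono (i : I) (ω : M.State) (Ψ : Set At) (h : Ψ ⊆ ω.1) :
    M.level i (M.proj ω Ψ h) ⊆ M.level i ω := by
  have hmem : M.proj ω (M.level i ω) (M.level_subset i ω) ∈ M.up (M.Pi i ω) :=
    ⟨M.level i ω, subset_rfl, by rw [M.proj_proj]; exact M.proj_level_mem i ω⟩
  exact ((SpaceLattice.mem_up (M.Pi_subset_level i _)).1
    (M.projections_preserve_ignorance i ω Ψ h hmem)).1

/-- One inclusion is implicit measurability with reflexivity of `Λ`. For the other, a projected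
state has the same `Π` as `ω`, by explicit measurability and stationarity; so it already sits at its
own level, and generalized reflexivity puts it into `Π`. -/
theorem Pi_eq (i : I) (ω : M.State) : M.Pi i ω = M.projSet (M.Lam i ω) (M.level i ω) := by
  have hmem := M.proj_level_mem i ω
  ext ω'
  refine ⟨fun h => ?_, ?_⟩
  · rw [← M.implicit_measurability i ω _ (M.Pi_subset_level i ω) ω' h]
    exact (M.implicit i).reflexivity ω'
  · rintro ⟨ω'', h, hle, rfl⟩
    have h' := (M.implicit i).proj_mem h (M.level_subset i ω) hle
    have hPi := (M.explicit_measurability i _ _ h').trans (M.stationarity i ω _ hmem)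
    have := M.proj_level_mem i (M.proj ω'' (M.level i ω) hle)
    rwa [M.proj_eq_self (M.proj ω'' _ hle) (M.level_congr hPi), hPi] at this

/-- The implicit knowledge-based HMS model in which the awareness level is the space of explicitly
possible states. -/
noncomputable def toImplicit : ImplicitHMSModel.{u, v, w} I At where
  toSpaceLattice := M.toSpaceLattice
  Lam := M.Lam
  α := M.level
  val := M.val
  Lam_nonempty i ω := ⟨ω, (M.implicit i).reflexivity ω⟩
  implicit := M.implicit
  lack_of_conception := M.level_subset
  awareness_measurability i ω ω' h := M.level_congr (M.explicit_measurability i ω ω' h)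
  awareness_below := M.level_below
  awareness_above i ω Ψ h hα := by
    refine (M.level_mono i ω Ψ h).antisymm ?_
    -- The level is attained again at the projection of `ω` to it, which is also a projection of
    -- `ω_Ψ`; monotonicity finishes.
    have h₁ := M.level_below i ω _ subset_rfl
    rw [← M.proj_proj ω h hα] at h₁
    exact h₁.symm.subset.trans (M.level_mono i (M.proj ω Ψ h) _ hα)
  awareness_mono := M.level_mono

theorem toImplicit_valid {φ : Form I At} : M.toImplicit.Valid φ ↔ M.Valid φ := by
  have hPi : M.toImplicit.derivedPi = M.Pi := by
    funext i ω
    exact (M.Pi_eq i ω).symm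
  have hA : M.AwareOf = fun i ω Φ => Φ ⊆ M.level i ω := by
    funext i ω Φ
    refine propext ⟨fun ⟨Ψ, hΨ, hΦ⟩ => ?_, fun h => ⟨_, M.Pi_subset_level i ω, h⟩⟩
    rwa [← M.eq_level hΨ]
  unfold ImplicitHMSModel.Valid ImplicitHMSModel.Sat Valid Sat
  rw [hA, hPi]
  exact Iff.rfl

end ComplementedHMSModel

/-- The two classes of HMS models validate the same formulas. -/
theorem validInComplementedHMS_iff {φ : Form I At} :
    ValidInComplementedHMS.{u, v, w} φ ↔ ValidInImplicitHMS.{u, v, w} φ :=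
  ⟨fun h M => M.toComplemented_valid.1 (h M.toComplemented),
    fun h M => M.toImplicit_valid.1 (h M.toImplicit)⟩

end Translations

/-! ### The canonical implicit knowledge-based HMS model -/

section CanonicalHMS

variable {I : Type u} {At : Type v} {X : Set (Form I At)}

open CanonicalWorld

/-- The lattice of spaces all of which are copies of the canonical frame. -/
def canonicalLattice (hne : Nonempty (CanonicalWorld.{u, v, w} X)) :
    SpaceLattice.{v, max u v w} At where
  S _ := CanonicalWorld.{u, v, w} X
  nonempty _ := hne
  r _ x := x
  r_surjective _ x := ⟨x, rfl⟩
  r_id _ _ := rfl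
  r_comp _ _ _ := rfl

/-- The canonical implicit knowledge-based HMS model. -/
def canonicalHMSModel (hne : Nonempty (CanonicalWorld.{u, v, w} X)) :
    ImplicitHMSModel.{u, v, max u v w} I At where
  toSpaceLattice := canonicalLattice hne
  Lam i ω := {ω' | ω'.1 = ω.1 ∧ Acc i ω.2 ω'.2}
  -- Intersecting with the index of the space turns the laws on projections into facts about
  -- intersections.
  α i ω := ω.1 ∩ awareAtoms i ω.2
  -- With base-space `S_{p}`, the base-space of `[φ]` is indexed by exactly the atoms of `φ`.
  val p := ⟨{p}, {ω | ω.1 = {p} ∧ Form.atom p ∈ formulas ω.2}, fun _ h => h.1⟩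
  Lam_nonempty i ω := ⟨ω, rfl, (acc_equivalence i).refl ω.2⟩
  implicit i :=
    { reflexivity := fun ω => ⟨rfl, (acc_equivalence i).refl ω.2⟩
      stationarity := fun ω ω' h => by
        ext ω''
        refine and_congr (by rw [h.1]) ⟨(acc_equivalence i).trans h.2,
          (acc_equivalence i).trans ((acc_equivalence i).symm h.2)⟩
      projections_preserve := fun ω Ψ h => by
        ext ω'
        refine ⟨?_, fun hω' => ?_⟩
        · rintro ⟨ω'', hω'', _, rfl⟩
          exact ⟨rfl, hω''.2⟩
        · obtain ⟨Ψ', y⟩ := ω'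
          obtain ⟨rfl, hy⟩ := hω'
          exact ⟨⟨ω.1, y⟩, ⟨rfl, hy⟩, h, rfl⟩ }
  lack_of_conception _ _ := Set.inter_subset_left
  awareness_measurability i ω ω' h := by rw [h.1, awareAtoms_eq h.2]
  awareness_below i ω Ψ h := Set.inter_eq_left.2 (h.trans Set.inter_subset_right)
  awareness_above i ω Ψ h hα :=
    (Set.inter_subset_inter_left _ h).antisymm (Set.subset_inter hα Set.inter_subset_right)
  awareness_mono i ω Ψ h := Set.inter_subset_inter_left _ h

theorem baseSpaceOf_canonicalHMSModel (hne : Nonempty (CanonicalWorld.{u, v, w} X))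
    (φ : Form I At) :
    SpaceLattice.baseSpaceOf (canonicalHMSModel hne).val φ = φ.atoms := by
  rw [SpaceLattice.baseSpaceOf_eq]
  exact Set.biUnion_of_singleton φ.atoms

/-- The truth lemma for the most expressive space of the canonical implicit knowledge-based HMS
model. -/
theorem canonicalHMSModel_sat (hne : Nonempty (CanonicalWorld.{u, v, w} X)) {φ : Form I At}
    (x : CanonicalWorld.{u, v, w} X) :
    (canonicalHMSModel hne).Sat ⟨Set.univ, x⟩ φ ↔ (canonicalFHModel hne Set.univ).Sat φ x := by
  rw [← (canonicalHMSModel hne).topFHModel_sat φ x]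
  -- The identity is a bounded morphism onto the canonical FH model, so its truth lemma need not be
  -- proved again for the HMS model.
  have hf : IsSurjectiveBoundedMorphism (Set.Subset.refl Set.univ)
      (canonicalHMSModel hne).topFHModel (canonicalFHModel hne Set.univ) id :=
    { surjective := Function.surjective_id
      atomic_harmony := fun p _ y => by
        refine (SpaceLattice.mem_up ((canonicalHMSModel hne).val p).base_subset).trans ?_
        exact ⟨fun h => h.2.2, fun h => ⟨Set.subset_univ _, rfl, h⟩⟩
      awareness_consistency := fun i y => by
        ext ψ
        have hψ : ψ ∈ (canonicalHMSModel hne).topFHModel.A i y ↔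
            ψ.atoms ⊆ Set.univ ∩ awareAtoms i y := by
          rw [← baseSpaceOf_canonicalHMSModel hne ψ]
          exact Iff.rfl
        exact (and_iff_left (Set.subset_univ _)).trans (hψ.trans Set.subset_inter_iff)
      homomorphism := fun _ _ _ h => h.2
      back := fun _ _ z h => ⟨z, rfl, rfl, h⟩ }
  exact hf.sat_iff (Set.subset_univ _) x

theorem provable_of_validInImplicitHMS {φ : Form I At}
    (hφ : φ.TopFree ∨ awarenessOfTop I At ⊆ X)
    (h : ValidInImplicitHMS.{u, v, max u v w} φ) : Provable X φ := by
  by_contra hn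
  obtain ⟨x, -, hx⟩ := exists_notMem.{u, v, w} fun hd : Deriv X ∅ φ => hn hd.provable
  refine hx ((canonicalFHModel_sat ⟨x⟩ hφ x).1 ((canonicalHMSModel_sat ⟨x⟩ x).1
    (h (canonicalHMSModel ⟨x⟩) ⟨Set.univ, x⟩ ?_)))
  exact SpaceLattice.definedAt_iff.2 (Set.subset_univ _)

end CanonicalHMS

/-- A logic between the core system and the full one is sound and complete for a language for which
awareness is propositionally determined. -/
theorem soundAndCompleteForAllClasses {I : Type u} {At : Type v} {X language : Set (Form I At)}
    (hX : X ⊆ awarenessOfTop I At)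
    (hlang : ∀ φ ∈ language, φ.TopFree ∨ awarenessOfTop I At ⊆ X) :
    SoundAndCompleteForAllClasses.{u, v, max u v w} language (Provable X) := by
  refine ⟨⟨fun φ _ h => validInFHCategories_of_theorem (h.mono hX),
      fun φ hφ h => provable_of_validInFHCategories.{u, v, w} (hlang φ hφ) h⟩,
    ⟨fun φ _ h => validInComplementedHMS_iff.2 fun M => M.valid_of_theorem (h.mono hX),
      fun φ hφ h => provable_of_validInImplicitHMS.{u, v, w} (hlang φ hφ)
        (validInComplementedHMS_iff.1 h)⟩,
    ⟨fun φ _ h M => M.valid_of_theorem (h.mono hX),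
      fun φ hφ h => provable_of_validInImplicitHMS.{u, v, w} (hlang φ hφ) h⟩⟩

end LPA

theorem mainTheorem1 (I : Type u) (At : Type v) [Nonempty I] [Nonempty At] :
    LPA.SoundAndCompleteForAllClasses.{u, v, max u v w} (I := I) (At := At)
      Set.univ LPA.Theorem ∧
    LPA.SoundAndCompleteForAllClasses.{u, v, max u v w} (I := I) (At := At)
      {φ | φ.TopFree} LPA.CoreTheorem :=
  ⟨LPA.soundAndCompleteForAllClasses.{u, v, w} subset_rfl fun _ _ => Or.inr subset_rfl,
    LPA.soundAndCompleteForAllClasses.{u, v, w} (Set.empty_subset _) fun _ h => Or.inl h⟩
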